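/- Let $k\ge 2$ be an integer and let $X$ be a non-degenerate real random variable with distribution function $F$ and $\mathbb{E}|X|^{2k}<\infty$. Write $\mu=\mathbb{E}X$, $\mu_j=\mathbb{E}(X-\mu)^j$ for $0\le j\le 2k$ (so $\mu_0=1$, $\mu_1=0$), and $\sigma=\sqrt{\mu_2}$. Let $X_1,X_2,\ldots$ be independent random variables with distribution $F$, and for $n\ge 1$ put \[ \bar X_n=\frac1n\sum_{i=1}^n X_i,\qquad M_{k,n}=\frac1n\sum_{i=1}^n (X_i-\bar X_n)^k . \] Suppose that $F$ is singular of order $k$, that is, $\sqrt n\,(M_{k,n}-\mu_k)\to 0$ in probability as $n\to\infty$. Then, as $n\to\infty$, \[ n(\mu_k-M_{k,n})\ \xrightarrow{\ d\ }\ \frac k2\left(\sigma\sqrt{\theta_k}+\alpha_k\right)Z_1^2-\frac k2\left(\sigma\sqrt{\theta_k}-\alpha_k\right)Z_2^2 , \] where $Z_1,Z_2$ are independent standard normal random variables and \[ \alpha_k=\mu_k-\tfrac12(k-1)\sigma^2\mu_{k-2},\qquad \theta_k=\mu_{2k-2}-\mu_{k-1}^2-(k-1)\mu_{k-2}\left[\mu_k-\tfrac14(k-1)\sigma^2\mu_{k-2}\right].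 \] -/

import Mathlib

open MeasureTheory ProbabilityTheory Filter Topology

noncomputable section

namespace SampleMoments

/-- The mean of the first `n` terms `x 0, …, x (n - 1)` of a sequence of observations. -/
def sampleMean (n : ℕ) (x : ℕ → ℝ) : ℝ :=
  (1 / (n : ℝ)) * ∑ i ∈ Finset.range n, x i

/-- The sample central moment `M_{k,n}` of order `k` of the first `n` terms
`x 0, …, x (n - 1)` of a sequence of observations. -/
def sampleCentralMoment (k n : ℕ) (x : ℕ → ℝ) : ℝ :=
  (1 / (n : ℝ)) * ∑ i ∈ Finset.range n, (x i - sampleMean n x) ^ k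

/-- The `j`-th central moment `μ_j = E (X - E X) ^ j` of a law `F` on the real line. -/
def cm (F : Measure ℝ) (j : ℕ) : ℝ :=
  centralMoment id j F

/-- The standard deviation `σ` of a law `F` on the real line. -/
def sd (F : Measure ℝ) : ℝ :=
  √(cm F 2)

/-- The set of points of increase of the distribution function of `F`. -/
def pointsOfIncrease (F : Measure ℝ) : Set ℝ :=
  {x | ∀ ε : ℝ, 0 < ε → 0 < cdf F (x + ε) - cdf F (x - ε)}

/-- A law on the real line is singular of order `k` if it is non-degenerate (its distribution
function has at least two points of increase), it has a finite absolute moment of order `2k`, and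
`√n (M_{k,n} - μ_k)` converges to zero in probability. Here `M_{k,n}` is computed from the first
`n` terms of the coordinate sequence under the infinite product measure `F ⊗ F ⊗ ⋯`, that is,
from an i.i.d. sample from `F`. -/
structure IsSingular (F : Measure ℝ) (k : ℕ) : Prop where
  nondegenerate : (pointsOfIncrease F).Nontrivial
  moment : Integrable (fun x : ℝ => |x| ^ (2 * k)) F
  tendsto_zero : TendstoInMeasure (Measure.infinitePi (fun _ : ℕ => F))
    (fun (n : ℕ) (x : ℕ → ℝ) => √(n : ℝ) * (sampleCentralMoment k n x - cm F k))
    atTop (fun _ => 0)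

/-- `α_k = μ_k - (k - 1) σ² μ_{k-2} / 2` (for `k ≥ 2`). -/
def alphaCoef (F : Measure ℝ) (k : ℕ) : ℝ :=
  cm F k - (1 / 2) * ((k : ℝ) - 1) * sd F ^ 2 * cm F (k - 2)

/-- `θ_k = μ_{2k-2} - μ_{k-1}² - (k - 1) μ_{k-2} (μ_k - (k - 1) σ² μ_{k-2} / 4)`
(for `k ≥ 2`). -/
def thetaCoef (F : Measure ℝ) (k : ℕ) : ℝ :=
  cm F (2 * k - 2) - cm F (k - 1) ^ 2 - ((k : ℝ) - 1) * cm F (k - 2) *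
    (cm F k - (1 / 4) * ((k : ℝ) - 1) * sd F ^ 2 * cm F (k - 2))

end SampleMoments

end

/-! Write `a_j` for the average of `(X_i - μ)^j`. The binomial expansion in `sampleCentralMoment_eq`
gives `M_{k,n} = a_k - k a_1 a_{k-1} + a_1² Q_n`, where `Q_n → k(k-1)μ_{k-2}/2` almost surely.
Singularity kills the normal limit of `√n (M_{k,n} - μ_k)`, so its variance vanishes and `(X-μ)^k =
μ_k + k μ_{k-1}(X-μ)` almost surely (`IsSingular.ae_cpow_eq`). Hence `a_k - μ_k = k μ_{k-1} a_1`
exactly and the order `√n` terms cancel. What remains is `n(μ_k - M_{k,n}) = k U V + U² o(1)`, with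
`U = √n a_1` and `V = √n (a_{k-1} - μ_{k-1} - (k-1)μ_{k-2} a_1/2)`. Jointly `(U, V)` is
asymptotically normal with variances `σ²`, `θ_k` and covariance `α_k`. Its limit can be realised as
`(σ(cZ₁ + dZ₂), √θ_k (cZ₁ - dZ₂))` with `c² + d² = 1`, so the product is a difference of squares and
no cross term arises. -/

namespace SampleMoments

/-! ### Limit theorems for averages of functions of the sample. -/

/-- **Cramér–Wold device** in dimension two. -/
theorem tendstoInDistribution_prodMk_of_linear {Ω Ω' : Type*} [MeasurableSpace Ω]
    [MeasurableSpace Ω'] {P : Measure Ω} [IsProbabilityMeasure P] {P' : Measure Ω'}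
    [IsProbabilityMeasure P'] {U V : ℕ → Ω → ℝ} {U' V' : Ω' → ℝ}
    (hU : ∀ n, AEMeasurable (U n) P) (hV : ∀ n, AEMeasurable (V n) P)
    (hU' : AEMeasurable U' P') (hV' : AEMeasurable V' P')
    (h : ∀ a b : ℝ, TendstoInDistribution (fun n ω => a * U n ω + b * V n ω) atTop
      (fun ω => a * U' ω + b * V' ω) (fun _ => P) P') :
    TendstoInDistribution (fun n ω => (U n ω, V n ω)) atTop (fun ω => (U' ω, V' ω))
      (fun _ => P) P' := by
  have key : TendstoInDistribution (fun n ω => !₂[U n ω, V n ω]) atTop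
      (fun ω => !₂[U' ω, V' ω]) (fun _ => P) P' := by
    have hm : ∀ n, AEMeasurable (fun ω => !₂[U n ω, V n ω]) P := fun n => by
      refine (PiLp.continuous_toLp 2 _).measurable.comp_aemeasurable (aemeasurable_pi_lambda _ ?_)
      intro i; fin_cases i
      · exact hU n
      · exact hV n
    have hm' : AEMeasurable (fun ω => !₂[U' ω, V' ω]) P' := by
      refine (PiLp.continuous_toLp 2 _).measurable.comp_aemeasurable (aemeasurable_pi_lambda _ ?_)
      intro i; fin_cases i
      · exact hU'
      · exact hV'
    refine ⟨hm, hm', ProbabilityMeasure.tendsto_iff_tendsto_charFun.2 fun t => ?_⟩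
    -- The joint characteristic function at `t` is that of the combination with coefficients `t 0`,
    -- `t 1`, evaluated at `1`.
    have h1 := ProbabilityMeasure.tendsto_iff_tendsto_charFun.1 (h (t 0) (t 1)).tendsto 1
    simp only [ProbabilityMeasure.coe_mk, charFun_apply] at h1 ⊢
    rw [integral_map hm' (by fun_prop)]
    rw [integral_map (h (t 0) (t 1)).aemeasurable_limit (by fun_prop)] at h1
    simp_rw [integral_map (hm _) (by fun_prop : AEStronglyMeasurable (fun x =>
      Complex.exp (((inner ℝ x t : ℝ) : ℂ) * Complex.I)) _)]
    simp_rw [integral_map ((h (t 0) (t 1)).forall_aemeasurable _)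
      (by fun_prop : AEStronglyMeasurable (fun x : ℝ =>
      Complex.exp (((inner ℝ x (1 : ℝ) : ℝ) : ℂ) * Complex.I)) _)] at h1
    simpa [PiLp.inner_apply, Fin.sum_univ_two] using h1
  exact key.continuous_comp (g := fun x => (x 0, x 1)) (by fun_prop)

theorem hasLaw_linear_gaussian {Ω' : Type*} [MeasurableSpace Ω'] {P' : Measure Ω'}
    [IsProbabilityMeasure P'] {Z₁ Z₂ : Ω' → ℝ} (hZ₁ : HasLaw Z₁ (gaussianReal 0 1) P')
    (hZ₂ : HasLaw Z₂ (gaussianReal 0 1) P') (hZ : IndepFun Z₁ Z₂ P') (a b : ℝ) :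
    HasLaw (fun ω => a * Z₁ ω + b * Z₂ ω) (gaussianReal 0 (a ^ 2 + b ^ 2).toNNReal) P' := by
  have h1 := gaussianReal_const_mul hZ₁ a
  have h2 := gaussianReal_const_mul hZ₂ b
  have h3 : IndepFun (fun ω => a * Z₁ ω) (fun ω => b * Z₂ ω) P' :=
    hZ.comp (φ := fun x => a * x) (ψ := fun x => b * x) (by fun_prop) (by fun_prop)
  refine ⟨h1.aemeasurable.add h2.aemeasurable, ?_⟩
  refine (gaussianReal_add_gaussianReal_of_indepFun h3 h1.map_eq h2.map_eq).trans ?_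
  congr 1
  · simp
  · ext
    rw [Real.coe_toNNReal _ (by positivity)]
    simp

/-- **Central limit theorem** for two functions of the observations. -/
theorem tendstoInDistribution_prodMk_inv_sqrt_mul_sum {Ω Ω' : Type*} [MeasurableSpace Ω]
    [MeasurableSpace Ω'] {P : Measure Ω} [IsProbabilityMeasure P] {P' : Measure Ω'}
    [IsProbabilityMeasure P'] {F : Measure ℝ} [IsProbabilityMeasure F] {X : ℕ → Ω → ℝ}
    (hX : ∀ i, HasLaw (X i) F P) (hXi : iIndepFun X P)
    {Z₁ Z₂ : Ω' → ℝ} (hZ₁ : HasLaw Z₁ (gaussianReal 0 1) P')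
    (hZ₂ : HasLaw Z₂ (gaussianReal 0 1) P') (hZ : IndepFun Z₁ Z₂ P')
    {f g : ℝ → ℝ} (hfm : Measurable f) (hgm : Measurable g)
    (hf : MemLp f 2 F) (hg : MemLp g 2 F) (hf0 : ∫ x, f x ∂F = 0) (hg0 : ∫ x, g x ∂F = 0)
    {u₁ u₂ w₁ w₂ : ℝ} (hff : ∫ x, f x * f x ∂F = u₁ ^ 2 + u₂ ^ 2)
    (hgg : ∫ x, g x * g x ∂F = w₁ ^ 2 + w₂ ^ 2) (hfg : ∫ x, f x * g x ∂F = u₁ * w₁ + u₂ * w₂) :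
    TendstoInDistribution
      (fun (n : ℕ) ω => ((√n)⁻¹ * ∑ i ∈ Finset.range n, f (X i ω),
        (√n)⁻¹ * ∑ i ∈ Finset.range n, g (X i ω))) atTop
      (fun ω => (u₁ * Z₁ ω + u₂ * Z₂ ω, w₁ * Z₁ ω + w₂ * Z₂ ω)) (fun _ => P) P' := by
  have hXm : ∀ i, AEMeasurable (X i) P := fun i => (hX i).aemeasurable
  have hm1 := hZ₁.aemeasurable
  have hm2 := hZ₂.aemeasurable
  refine tendstoInDistribution_prodMk_of_linear (fun n => ?_) (fun n => ?_)
    (by fun_prop) (by fun_prop) fun a b => ?_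
  · exact (Finset.aemeasurable_fun_sum _ fun i _ => hfm.comp_aemeasurable (hXm i)).const_mul _
  · exact (Finset.aemeasurable_fun_sum _ fun i _ => hgm.comp_aemeasurable (hXm i)).const_mul _
  set h : ℝ → ℝ := fun x => a * f x + b * g x with hh
  have hhm : Measurable h := by fun_prop
  have hh2 : MemLp h 2 F := (hf.const_mul a).add (hg.const_mul b)
  have hh0 : ∫ x, h x ∂F = 0 := by
    rw [hh, integral_add ((hf.integrable one_le_two).const_mul a)
      ((hg.integrable one_le_two).const_mul b), integral_const_mul, integral_const_mul, hf0, hg0]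
    simp
  have hvar : ∫ x, h x ^ 2 ∂F = (a * u₁ + b * w₁) ^ 2 + (a * u₂ + b * w₂) ^ 2 := by
    have e : ∀ x, h x ^ 2 = a ^ 2 * (f x * f x) + 2 * a * b * (f x * g x)
        + b ^ 2 * (g x * g x) := fun x => by simp only [hh]; ring
    simp_rw [e]
    have i1 : Integrable (fun x => f x * f x) F := hf.integrable_mul hf
    have i2 : Integrable (fun x => f x * g x) F := hf.integrable_mul hg
    have i3 : Integrable (fun x => g x * g x) F := hg.integrable_mul hg
    have j1 := i1.const_mul (a ^ 2)
    have j2 := i2.const_mul (2 * a * b)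
    have j12 : Integrable (fun x => a ^ 2 * (f x * f x) + 2 * a * b * (f x * g x)) F := j1.add j2
    rw [integral_add j12 (i3.const_mul _), integral_add j1 j2, integral_const_mul, integral_const_mul,
      integral_const_mul, hff, hgg, hfg]
    ring
  have hc0 : ∫ ω, h (X 0 ω) ∂P = 0 := by
    rw [← hh0]
    exact (hX 0).integral_comp hhm.aestronglyMeasurable
  have hcv : Var[fun ω => h (X 0 ω); P] = (a * u₁ + b * w₁) ^ 2 + (a * u₂ + b * w₂) ^ 2 := by
    rw [variance_of_integral_eq_zero (X := fun ω => h (X 0 ω)) (hhm.comp_aemeasurable (hXm 0)) hc0, ← hvar]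
    exact (hX 0).integral_comp (f := fun x => h x ^ 2) (by fun_prop)
  have hid : ∀ i, IdentDistrib (X i) (X 0) P P := fun i =>
    ⟨hXm i, hXm 0, by rw [(hX i).map_eq, (hX 0).map_eq]⟩
  have hL : MemLp (fun ω => h (X 0 ω)) 2 P := by
    have := hh2
    rw [← (hX 0).map_eq] at this
    exact this.comp_of_map (hXm 0)
  have hclt := tendstoInDistribution_inv_sqrt_mul_sum_sub (P := P) (P' := P')
    (X := fun i ω => h (X i ω))
    (Y := fun ω => (a * u₁ + b * w₁) * Z₁ ω + (a * u₂ + b * w₂) * Z₂ ω)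
    (by rw [hcv]; exact hasLaw_linear_gaussian hZ₁ hZ₂ hZ _ _) hL
    (hXi.comp (fun _ => h) fun _ => hhm) (fun i => (hid i).comp hhm)
  have e1 : ∀ (n : ℕ) ω, (√n)⁻¹ * (∑ i ∈ Finset.range n, h (X i ω) - n * ∫ ω, h (X 0 ω) ∂P) =
      a * ((√n)⁻¹ * ∑ i ∈ Finset.range n, f (X i ω)) +
        b * ((√n)⁻¹ * ∑ i ∈ Finset.range n, g (X i ω)) := fun n ω => by
    rw [hc0]
    simp only [hh, Finset.sum_add_distrib, ← Finset.mul_sum]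
    ring
  have e2 : ∀ ω, (a * u₁ + b * w₁) * Z₁ ω + (a * u₂ + b * w₂) * Z₂ ω =
      a * (u₁ * Z₁ ω + u₂ * Z₂ ω) + b * (w₁ * Z₁ ω + w₂ * Z₂ ω) := fun ω => by ring
  simpa only [e1, e2] using hclt

/-- Strong law of large numbers for functions of the observations. -/
theorem ae_tendsto_average {Ω : Type*} [MeasurableSpace Ω]
    {P : Measure Ω} [IsProbabilityMeasure P] {F : Measure ℝ} {X : ℕ → Ω → ℝ}
    (hX : ∀ i, HasLaw (X i) F P) (hXi : iIndepFun X P) {f : ℝ → ℝ} (hfm : Measurable f)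
    (hf : Integrable f F) :
    ∀ᵐ ω ∂P, Tendsto (fun n : ℕ => (n : ℝ)⁻¹ * ∑ i ∈ Finset.range n, f (X i ω)) atTop
      (𝓝 (∫ x, f x ∂F)) := by
  have hXm : ∀ i, AEMeasurable (X i) P := fun i => (hX i).aemeasurable
  have hid : ∀ i, IdentDistrib (X i) (X 0) P P := fun i =>
    ⟨hXm i, hXm 0, by rw [(hX i).map_eq, (hX 0).map_eq]⟩
  have hi : Integrable (fun ω => f (X 0 ω)) P := by
    rw [← (hX 0).map_eq] at hf
    exact hf.comp_aemeasurable (hXm 0)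
  have := strong_law_ae (μ := P) (fun i ω => f (X i ω)) hi
    (fun i j hij => (hXi.indepFun hij).comp hfm hfm) (fun i => (hid i).comp hfm)
  have e : ∫ ω, f (X 0 ω) ∂P = ∫ x, f x ∂F := (hX 0).integral_comp hfm.aestronglyMeasurable
  rw [e] at this
  simpa using this

/-! ### Expansion of the sample central moment. -/

/-- The average of the `j`-th powers of `x i - c` over the first `n` terms. -/
noncomputable def powAvg (c : ℝ) (n : ℕ) (x : ℕ → ℝ) (j : ℕ) : ℝ :=
  (n : ℝ)⁻¹ * ∑ i ∈ Finset.range n, (x i - c) ^ j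

/-- The terms of order at least two in the expansion of the sample central moment of order
`m + 2` in powers of the centred sample mean, divided by the square of that mean. -/
noncomputable def quadTail (c : ℝ) (m n : ℕ) (x : ℕ → ℝ) : ℝ :=
  ∑ j ∈ Finset.range (m + 1),
    ((m + 2).choose (j + 2) : ℝ) * (-powAvg c n x 1) ^ j * powAvg c n x (m - j)

theorem sampleMean_eq (c : ℝ) {n : ℕ} (hn : n ≠ 0) (x : ℕ → ℝ) :
    sampleMean n x = c + powAvg c n x 1 := by
  have : (n : ℝ) ≠ 0 := by exact_mod_cast hn
  simp only [sampleMean, powAvg, pow_one, Finset.sum_sub_distrib, Finset.sum_const,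
    Finset.card_range, nsmul_eq_mul]
  field_simp
  ring

theorem sampleCentralMoment_eq (c : ℝ) (m : ℕ) {n : ℕ} (hn : n ≠ 0) (x : ℕ → ℝ) :
    sampleCentralMoment (m + 2) n x = powAvg c n x (m + 2) -
      (m + 2) * powAvg c n x 1 * powAvg c n x (m + 1) +
      powAvg c n x 1 ^ 2 * quadTail c m n x := by
  have hx : ∀ i, (x i - sampleMean n x) ^ (m + 2) = ∑ j ∈ Finset.range (m + 3),
      ((m + 2).choose j : ℝ) * (-powAvg c n x 1) ^ j * (x i - c) ^ (m + 2 - j) := fun i => by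
    rw [sampleMean_eq c hn x,
      show x i - (c + powAvg c n x 1) = -powAvg c n x 1 + (x i - c) by ring, add_pow]
    exact Finset.sum_congr rfl fun j _ => by ring
  have hs : sampleCentralMoment (m + 2) n x = ∑ j ∈ Finset.range (m + 3),
      ((m + 2).choose j : ℝ) * (-powAvg c n x 1) ^ j * powAvg c n x (m + 2 - j) := by
    simp only [sampleCentralMoment, hx]
    rw [Finset.sum_comm, Finset.mul_sum]
    refine Finset.sum_congr rfl fun j _ => ?_
    rw [← Finset.mul_sum]
    simp only [powAvg]
    ring
  -- The terms of degree zero and one are split off; the rest is divisible by the squared centred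
  -- mean.
  rw [hs, Finset.sum_range_succ', Finset.sum_range_succ', quadTail, Finset.mul_sum]
  have : ∀ j ∈ Finset.range (m + 1), ((m + 2).choose (j + 1 + 1) : ℝ) *
      (-powAvg c n x 1) ^ (j + 1 + 1) * powAvg c n x (m + 2 - (j + 1 + 1)) =
      powAvg c n x 1 ^ 2 * (((m + 2).choose (j + 2) : ℝ) * (-powAvg c n x 1) ^ j *
        powAvg c n x (m - j)) := fun j _ => by
    rw [show m + 2 - (j + 1 + 1) = m - j by omega]
    ring
  rw [Finset.sum_congr rfl this]
  simp
  ring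

/-! ### Central moments of the law. -/

section Law

variable {F : Measure ℝ} {k : ℕ}

/-- The centred `j`-th power under the law `F`. -/
noncomputable def cpow (F : Measure ℝ) (j : ℕ) (x : ℝ) : ℝ := (x - ∫ y, y ∂F) ^ j

@[fun_prop]
theorem measurable_cpow (j : ℕ) : Measurable (cpow F j) := by
  unfold cpow; fun_prop

theorem cpow_mul_cpow (i j : ℕ) (x : ℝ) : cpow F i x * cpow F j x = cpow F (i + j) x :=
  (pow_add _ _ _).symm

theorem integral_cpow_eq_cm (j : ℕ) : ∫ x, cpow F j x ∂F = cm F j := by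
  simp [cpow, cm, centralMoment]

theorem integrable_cpow [IsProbabilityMeasure F] (h : Integrable (fun x : ℝ => |x| ^ (2 * k)) F) {j : ℕ}
    (hj : j ≤ 2 * k) : Integrable (cpow F j) F := by
  have h1 : MemLp (fun x : ℝ => x) ((2 * k : ℕ) : ENNReal) F := by
    rcases Nat.eq_zero_or_pos k with rfl | hk
    · simpa using (by fun_prop : AEStronglyMeasurable (fun x : ℝ => x) F)
    · rw [← integrable_norm_rpow_iff (p := ((2 * k : ℕ) : ENNReal)) (by fun_prop)
        (by simpa using hk.ne') (ENNReal.natCast_ne_top _), ENNReal.toReal_natCast]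
      simpa only [Real.rpow_natCast, Real.norm_eq_abs] using h
  have h2 : MemLp (fun x : ℝ => x - ∫ y, y ∂F) ((2 * k : ℕ) : ENNReal) F :=
    h1.sub (memLp_const _)
  have h3 : MemLp (fun x : ℝ => x - ∫ y, y ∂F) (j : ENNReal) F :=
    h2.mono_exponent (by exact_mod_cast hj)
  refine (integrable_norm_iff (by fun_prop)).1 ?_
  have := h3.integrable_norm_pow'
  simpa [cpow] using this

theorem memLp_cpow [IsProbabilityMeasure F] (h : Integrable (fun x : ℝ => |x| ^ (2 * k)) F) {j : ℕ}
    (hj : j ≤ k) : MemLp (cpow F j) 2 F := by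
  rw [memLp_two_iff_integrable_sq (by fun_prop)]
  simpa [pow_two, cpow_mul_cpow, ← two_mul] using integrable_cpow h (by omega : j + j ≤ 2 * k)

theorem cm_one [IsProbabilityMeasure F] : cm F 1 = 0 := centralMoment_one

theorem sd_sq : sd F ^ 2 = cm F 2 :=
  Real.sq_sqrt (by rw [← integral_cpow_eq_cm]; exact integral_nonneg fun x => by unfold cpow; positivity)

end Law

/-! ### Representing a covariance matrix by a point of the unit circle. -/

theorem exists_sq_add_sq_eq_one {A B C : ℝ} (hA : 0 ≤ A) (hB : 0 ≤ B) (h : C ^ 2 ≤ A * B) :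
    ∃ c d : ℝ, c ^ 2 + d ^ 2 = 1 ∧ √A * √B * (c ^ 2 - d ^ 2) = C := by
  set s := √A * √B with hs
  have hs2 : s ^ 2 = A * B := by rw [hs, mul_pow, Real.sq_sqrt hA, Real.sq_sqrt hB]
  have hs0 : 0 ≤ s := by positivity
  have hC : |C| ≤ s := abs_le_of_sq_le_sq (hs2 ▸ h) hs0
  have hr : |C / s| ≤ 1 := by
    rw [abs_div, abs_of_nonneg hs0]
    exact div_le_one_of_le₀ hC hs0
  obtain ⟨h1, h2⟩ := abs_le.1 hr
  -- These solve `c² + d² = 1`, `s(c² - d²) = C`. If `s = 0` then `C = 0`, and `C / s = 0` still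
  -- gives a valid pair.
  refine ⟨√((1 + C / s) / 2), √((1 - C / s) / 2), ?_, ?_⟩
  · rw [Real.sq_sqrt (by linarith), Real.sq_sqrt (by linarith)]
    ring
  · rw [Real.sq_sqrt (by linarith), Real.sq_sqrt (by linarith)]
    rcases hs0.eq_or_lt with h0 | h0
    · have : C = 0 := by rw [← h0] at hC; exact abs_nonpos_iff.1 hC
      rw [← h0, this]; ring
    · field_simp
      ring

/-- The quadratic `t ↦ ∫ (t f + g)²` is nonnegative, so its discriminant is at most zero. -/
theorem sq_integral_mul_le {F : Measure ℝ} {f g : ℝ → ℝ} (hf : MemLp f 2 F) (hg : MemLp g 2 F) :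
    (∫ x, f x * g x ∂F) ^ 2 ≤ (∫ x, f x * f x ∂F) * ∫ x, g x * g x ∂F := by
  have i1 : Integrable (fun x => f x * f x) F := hf.integrable_mul hf
  have i2 : Integrable (fun x => f x * g x) F := hf.integrable_mul hg
  have i3 : Integrable (fun x => g x * g x) F := hg.integrable_mul hg
  have key : ∀ t : ℝ, 0 ≤ (∫ x, f x * f x ∂F) * (t * t) + (2 * ∫ x, f x * g x ∂F) * t
      + ∫ x, g x * g x ∂F := fun t => by
    have j1 := i1.mul_const (t * t)
    have j2 := i2.mul_const (2 * t)
    have j12 : Integrable (fun x => f x * f x * (t * t) + f x * g x * (2 * t)) F := j1.add j2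
    have : (0 : ℝ) ≤ ∫ x, f x * f x * (t * t) + f x * g x * (2 * t) + g x * g x ∂F :=
      integral_nonneg fun x => by
        have : 0 ≤ (f x * t + g x) ^ 2 := sq_nonneg _
        simp only [Pi.zero_apply]
        linarith
    rw [integral_add j12 i3, integral_add j1 j2, integral_mul_const, integral_mul_const] at this
    linarith
  have := discrim_le_zero key
  rw [discrim] at this
  linarith

/-! ### Joint central limit theorem and almost sure limits. -/

section Sample

variable {Ω Ω' : Type*} [MeasurableSpace Ω] [MeasurableSpace Ω'] {P : Measure Ω}
  [IsProbabilityMeasure P] {P' : Measure Ω'} [IsProbabilityMeasure P'] {F : Measure ℝ}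
  [IsProbabilityMeasure F] {X : ℕ → Ω → ℝ} {Z₁ Z₂ : Ω' → ℝ}

/-- Two-dimensional central limit theorem with the limit expressed through independent
standard normal variables. -/
theorem exists_tendstoInDistribution_prodMk (hX : ∀ i, HasLaw (X i) F P) (hXi : iIndepFun X P)
    (hZ₁ : HasLaw Z₁ (gaussianReal 0 1) P')
    (hZ₂ : HasLaw Z₂ (gaussianReal 0 1) P') (hZ : IndepFun Z₁ Z₂ P')
    {f g : ℝ → ℝ} (hfm : Measurable f) (hgm : Measurable g)
    (hf : MemLp f 2 F) (hg : MemLp g 2 F) (hf0 : ∫ x, f x ∂F = 0) (hg0 : ∫ x, g x ∂F = 0)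
    {A B C : ℝ} (hff : ∫ x, f x * f x ∂F = A) (hgg : ∫ x, g x * g x ∂F = B)
    (hfg : ∫ x, f x * g x ∂F = C) :
    ∃ c d : ℝ, c ^ 2 + d ^ 2 = 1 ∧ √A * √B * (c ^ 2 - d ^ 2) = C ∧
    TendstoInDistribution
      (fun (n : ℕ) ω => ((√n)⁻¹ * ∑ i ∈ Finset.range n, f (X i ω),
        (√n)⁻¹ * ∑ i ∈ Finset.range n, g (X i ω))) atTop
      (fun ω => (√A * c * Z₁ ω + √A * d * Z₂ ω, √B * c * Z₁ ω + -(√B * d) * Z₂ ω))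
      (fun _ => P) P' := by
  have hA : 0 ≤ A := hff ▸ integral_nonneg fun x => mul_self_nonneg _
  have hB : 0 ≤ B := hgg ▸ integral_nonneg fun x => mul_self_nonneg _
  obtain ⟨c, d, h1, h2⟩ := exists_sq_add_sq_eq_one (C := C) hA hB
    (by rw [← hff, ← hgg, ← hfg]; exact sq_integral_mul_le hf hg)
  refine ⟨c, d, h1, h2, tendstoInDistribution_prodMk_inv_sqrt_mul_sum hX hXi hZ₁ hZ₂ hZ hfm hgm
    hf hg hf0 hg0 ?_ ?_ ?_⟩
  · rw [hff, mul_pow, mul_pow, Real.sq_sqrt hA, ← mul_add, h1, mul_one]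
  · rw [hgg, neg_sq, mul_pow, mul_pow, Real.sq_sqrt hB, ← mul_add, h1, mul_one]
  · rw [hfg, ← h2]; ring

@[fun_prop]
theorem measurable_powAvg (c : ℝ) (n j : ℕ) : Measurable fun x => powAvg c n x j := by
  unfold powAvg; fun_prop

@[fun_prop]
theorem measurable_quadTail (c : ℝ) (m n : ℕ) : Measurable (quadTail c m n) := by
  unfold quadTail; fun_prop

theorem inv_sqrt_mul (n : ℕ) (a : ℝ) : (√(n : ℝ))⁻¹ * a = √n * ((n : ℝ)⁻¹ * a) := by
  rcases Nat.eq_zero_or_pos n with rfl | hn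
  · simp
  · have h : 0 < √(n : ℝ) := by positivity
    nth_rw 3 [← Real.sq_sqrt (Nat.cast_nonneg n)]
    field_simp

theorem ae_tendsto_powAvg {k : ℕ} (hX : ∀ i, HasLaw (X i) F P) (hXi : iIndepFun X P)
    (h : Integrable (fun x : ℝ => |x| ^ (2 * k)) F) :
    ∀ᵐ ω ∂P, ∀ j ≤ 2 * k, Tendsto (fun n => powAvg (∫ y, y ∂F) n (fun i => X i ω) j) atTop
      (𝓝 (cm F j)) := by
  refine ae_all_iff.2 fun j => ?_
  by_cases hj : j ≤ 2 * k
  · filter_upwards [ae_tendsto_average hX hXi (measurable_cpow j) (integrable_cpow h hj)]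
      with ω hω _
    rwa [integral_cpow_eq_cm] at hω
  · exact ae_of_all _ fun _ h' => absurd h' hj

/-- The centred mean tends to zero, so only the term `j = 0` survives. -/
theorem ae_tendsto_quadTail {m : ℕ} (hX : ∀ i, HasLaw (X i) F P) (hXi : iIndepFun X P)
    (h : Integrable (fun x : ℝ => |x| ^ (2 * (m + 2))) F) :
    ∀ᵐ ω ∂P, Tendsto (fun n => quadTail (∫ y, y ∂F) m n (fun i => X i ω)) atTop
      (𝓝 (((m : ℝ) + 2) * (m + 1) / 2 * cm F m)) := by
  filter_upwards [ae_tendsto_powAvg hX hXi h] with ω hω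
  have h1 := (hω 1 (by omega)).neg
  have h2 := tendsto_finsetSum (Finset.range (m + 1)) fun j _ =>
    ((h1.pow j).const_mul ((m + 2).choose (j + 2) : ℝ)).mul (hω (m - j) (by omega))
  convert h2 using 1
  congr 1
  rw [cm_one, Finset.sum_eq_single 0]
  · rw [Nat.cast_choose_two]
    push_cast
    rw [pow_zero, Nat.sub_zero]
    ring_nf
  · intro j _ hj
    simp [hj]
  · simp

theorem tendstoInMeasure_of_ae_tendsto_comp {G : ℕ → (ℕ → ℝ) → ℝ} (hG : ∀ n, Measurable (G n))
    (hX : ∀ i, AEMeasurable (X i) P) {a : ℝ}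
    (h : ∀ᵐ ω ∂P, Tendsto (fun n => G n (fun i => X i ω)) atTop (𝓝 a)) :
    (∀ n, AEMeasurable (fun ω => G n (fun i => X i ω)) P) ∧
      TendstoInMeasure P (fun n ω => G n (fun i => X i ω)) atTop fun _ => a := by
  have : ∀ n, AEMeasurable (fun ω => G n (fun i => X i ω)) P := fun n =>
    (hG n).comp_aemeasurable (aemeasurable_pi_lambda _ hX)
  exact ⟨this, tendstoInMeasure_of_tendsto_ae (fun n => (this n).aestronglyMeasurable) h⟩

end Sample

/-! ### Consequence of singularity. -/

/-- For a singular law the influence function of the central moment vanishes almost surely. -/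
theorem IsSingular.ae_cpow_eq {F : Measure ℝ} [IsProbabilityMeasure F] {m : ℕ}
    (hF : IsSingular F (m + 2)) :
    ∀ᵐ x ∂F, cpow F (m + 2) x = cm F (m + 2) + (m + 2) * cm F (m + 1) * cpow F 1 x := by
  set f : ℝ → ℝ := fun x => cpow F (m + 2) x - cm F (m + 2) - (m + 2) * cm F (m + 1) * cpow F 1 x
    with hf
  have hfm : Measurable f := by fun_prop
  have L1 := memLp_cpow hF.moment (by omega : 1 ≤ m + 2)
  have L2 : MemLp f 2 F := ((memLp_cpow hF.moment le_rfl).sub (memLp_const _)).sub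
    (L1.const_mul _)
  have i1 : Integrable (cpow F 1) F := L1.integrable one_le_two
  have ik : Integrable (cpow F (m + 2)) F := (memLp_cpow hF.moment le_rfl).integrable one_le_two
  have hf0 : ∫ x, f x ∂F = 0 := by
    have j : Integrable (fun x => cpow F (m + 2) x - cm F (m + 2)) F := ik.sub (integrable_const _)
    rw [hf, integral_sub j (i1.const_mul _), integral_sub ik (integrable_const _),
      integral_const_mul, integral_cpow_eq_cm, integral_cpow_eq_cm, cm_one]
    simp
  have hg0 : ∫ x, cpow F 1 x ∂F = 0 := by rw [integral_cpow_eq_cm, cm_one]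
  set P := Measure.infinitePi (fun _ : ℕ => F)
  have hX : ∀ i, HasLaw (fun x : ℕ → ℝ => x i) F P := fun i =>
    (measurePreserving_eval_infinitePi (fun _ : ℕ => F) i).hasLaw
  have hXi : iIndepFun (fun i (x : ℕ → ℝ) => x i) P :=
    iIndepFun_infinitePi (X := fun _ x => x) fun _ => measurable_id
  have hXm := fun i => (hX i).aemeasurable
  set γ := gaussianReal 0 1
  have hZ₁ : HasLaw (Prod.fst : ℝ × ℝ → ℝ) γ (γ.prod γ) := measurePreserving_fst.hasLaw
  have hZ₂ : HasLaw (Prod.snd : ℝ × ℝ → ℝ) γ (γ.prod γ) := measurePreserving_snd.hasLaw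
  have hZ : IndepFun (Prod.fst : ℝ × ℝ → ℝ) Prod.snd (γ.prod γ) :=
    (indepFun_iff_hasLaw_prodMk_prod hZ₁ hZ₂).2 HasLaw.id
  obtain ⟨c, d, hcd, -, hclt⟩ := exists_tendstoInDistribution_prodMk hX hXi hZ₁ hZ₂ hZ hfm
    (measurable_cpow 1) L2 L1 hf0 hg0 rfl rfl rfl
  set A := ∫ x, f x * f x ∂F with hA
  have hA0 : 0 ≤ A := integral_nonneg fun x => mul_self_nonneg _
  set μ := ∫ y, y ∂F with hμ
  -- The expansion is the average of `f` plus the centred mean times `G`; since `G → 0`, Slutsky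
  -- leaves only the normal limit of `f`.
  let G : ℕ → (ℕ → ℝ) → ℝ := fun n x => -((m + 2) * (powAvg μ n x (m + 1) - cm F (m + 1))) +
    powAvg μ n x 1 * quadTail μ m n x
  obtain ⟨hGm, hG⟩ := tendstoInMeasure_of_ae_tendsto_comp (P := P) (G := G) (a := 0)
    (fun n => by fun_prop) hXm (by
      filter_upwards [ae_tendsto_powAvg hX hXi hF.moment, ae_tendsto_quadTail hX hXi hF.moment]
        with x h1 h2
      convert! (((h1 (m + 1) (by omega)).sub_const (cm F (m + 1))).const_mul ((m : ℝ) + 2)).neg.add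
        ((h1 1 (by omega)).mul h2) using 2
      rw [cm_one, sub_self, mul_zero, neg_zero, zero_mul, add_zero])
  have hlim := hclt.continuous_comp_prodMk_of_tendstoInMeasure_const
    (g := fun p : (ℝ × ℝ) × ℝ => p.1.1 + p.1.2 * p.2) (by fun_prop) hG hGm
  have hlim0 := hF.tendsto_zero.tendstoInDistribution
    (fun n => by unfold sampleCentralMoment sampleMean; fun_prop)
  have heq : ∀ (n : ℕ) (x : ℕ → ℝ), (√n)⁻¹ * ∑ i ∈ Finset.range n, f (x i) +
      ((√n)⁻¹ * ∑ i ∈ Finset.range n, cpow F 1 (x i)) * G n x =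
      √n * (sampleCentralMoment (m + 2) n x - cm F (m + 2)) := fun n x => by
    rcases eq_or_ne n 0 with rfl | hn
    · simp
    have e1 : (n : ℝ)⁻¹ * ∑ i ∈ Finset.range n, f (x i) = powAvg μ n x (m + 2) - cm F (m + 2) -
        (m + 2) * cm F (m + 1) * powAvg μ n x 1 := by
      simp only [hf, cpow, powAvg, Finset.sum_sub_distrib, ← Finset.mul_sum, Finset.sum_const,
        Finset.card_range, nsmul_eq_mul, hμ]
      field_simp
    have e2 : (n : ℝ)⁻¹ * ∑ i ∈ Finset.range n, cpow F 1 (x i) = powAvg μ n x 1 := rfl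
    rw [inv_sqrt_mul, inv_sqrt_mul, e1, e2, sampleCentralMoment_eq μ m hn]
    ring
  simp only [heq, mul_zero, add_zero] at hlim
  have hlaw := tendstoInDistribution_unique _ hlim hlim0
  rw [(hasLaw_linear_gaussian hZ₁ hZ₂ hZ _ _).map_eq, Measure.map_const, measure_univ, one_smul,
    mul_pow, mul_pow, ← mul_add, hcd, mul_one, Real.sq_sqrt hA0] at hlaw
  -- A normal law with variance `A` equals a point mass; compare variances.
  have hAz : A = 0 := by
    have := congrArg (fun ν : Measure ℝ => Var[id; ν]) hlaw
    simpa [variance_id_gaussianReal, hA0, variance_eq_integral] using this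
  rw [hA, integral_eq_zero_iff_of_nonneg (fun x => mul_self_nonneg _) (L2.integrable_mul L2)]
    at hAz
  filter_upwards [hAz] with x hx
  have := mul_self_eq_zero.1 hx
  simp only [hf] at this
  linarith

/-! ### Identification of `α` and `θ` as second moments. -/

section Coefficients

variable {F : Measure ℝ} {m : ℕ}

/-- The centred power of order `m + 1`, corrected by a multiple of the centred observation; its
variance is `θ` and its covariance with the observation is `α`. -/
noncomputable def corrPow (F : Measure ℝ) (m : ℕ) (x : ℝ) : ℝ :=
  cpow F (m + 1) x - cm F (m + 1) - (m + 1) / 2 * cm F m * cpow F 1 x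

@[fun_prop]
theorem measurable_corrPow : Measurable (corrPow F m) := by
  unfold corrPow; fun_prop

theorem memLp_corrPow [IsProbabilityMeasure F]
    (h : Integrable (fun x : ℝ => |x| ^ (2 * (m + 2))) F) :
    MemLp (corrPow F m) 2 F :=
  ((memLp_cpow h (by omega)).sub (memLp_const _)).sub ((memLp_cpow h (by omega)).const_mul _)

theorem integral_corrPow [IsProbabilityMeasure F]
    (h : Integrable (fun x : ℝ => |x| ^ (2 * (m + 2))) F) :
    ∫ x, corrPow F m x ∂F = 0 := by
  have i1 : Integrable (cpow F 1) F := integrable_cpow h (by omega)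
  have i2 : Integrable (cpow F (m + 1)) F := integrable_cpow h (by omega)
  have j : Integrable (fun x => cpow F (m + 1) x - cm F (m + 1)) F := i2.sub (integrable_const _)
  simp only [corrPow]
  rw [integral_sub j (i1.const_mul _), integral_sub i2 (integrable_const _),
    integral_const_mul, integral_cpow_eq_cm, integral_cpow_eq_cm, cm_one]
  simp

/-- The case `j = 1` yields `α`; the case `j = m + 1` enters the computation of `θ`. -/
theorem integral_cpow_mul_corrPow [IsProbabilityMeasure F]
    (h : Integrable (fun x : ℝ => |x| ^ (2 * (m + 2))) F) {j : ℕ}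
    (hj : j ≤ m + 2) : ∫ x, cpow F j x * corrPow F m x ∂F =
      cm F (j + (m + 1)) - cm F (m + 1) * cm F j - (m + 1) / 2 * cm F m * cm F (j + 1) := by
  have e : ∀ x, cpow F j x * corrPow F m x = cpow F (j + (m + 1)) x - cm F (m + 1) * cpow F j x -
      (m + 1) / 2 * cm F m * cpow F (j + 1) x := fun x => by
    rw [← cpow_mul_cpow j (m + 1), ← cpow_mul_cpow j 1, corrPow]; ring
  have i1 : Integrable (cpow F (j + (m + 1))) F := integrable_cpow h (by omega)
  have i2 : Integrable (cpow F j) F := integrable_cpow h (by omega)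
  have i3 : Integrable (cpow F (j + 1)) F := integrable_cpow h (by omega)
  have i12 : Integrable (fun x => cpow F (j + (m + 1)) x - cm F (m + 1) * cpow F j x) F :=
    i1.sub (i2.const_mul _)
  simp_rw [e]
  rw [integral_sub i12 (i3.const_mul _), integral_sub i1 (i2.const_mul _), integral_const_mul,
    integral_const_mul, integral_cpow_eq_cm, integral_cpow_eq_cm, integral_cpow_eq_cm]

theorem integral_cpow_one_mul_corrPow [IsProbabilityMeasure F]
    (h : Integrable (fun x : ℝ => |x| ^ (2 * (m + 2))) F) :
    ∫ x, cpow F 1 x * corrPow F m x ∂F = alphaCoef F (m + 2) := by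
  rw [integral_cpow_mul_corrPow h (by omega), cm_one, alphaCoef, sd_sq,
    show 1 + (m + 1) = m + 2 by omega, Nat.add_sub_cancel]
  push_cast
  ring

theorem integral_corrPow_mul_corrPow [IsProbabilityMeasure F]
    (h : Integrable (fun x : ℝ => |x| ^ (2 * (m + 2))) F) :
    ∫ x, corrPow F m x * corrPow F m x ∂F = thetaCoef F (m + 2) := by
  have e : ∀ x, corrPow F m x * corrPow F m x = cpow F (m + 1) x * corrPow F m x -
      cm F (m + 1) * corrPow F m x -
      (m + 1) / 2 * cm F m * (cpow F 1 x * corrPow F m x) := fun x => by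
    nth_rw 1 [corrPow]; ring
  have L := memLp_corrPow h
  have i1 : Integrable (fun x => cpow F (m + 1) x * corrPow F m x) F :=
    (memLp_cpow h (by omega)).integrable_mul L
  have i2 : Integrable (corrPow F m) F := L.integrable one_le_two
  have i3 : Integrable (fun x => cpow F 1 x * corrPow F m x) F :=
    (memLp_cpow h (by omega)).integrable_mul L
  have i12 : Integrable (fun x => cpow F (m + 1) x * corrPow F m x -
      cm F (m + 1) * corrPow F m x) F := i1.sub (i2.const_mul _)
  simp_rw [e]
  rw [integral_sub i12 (i3.const_mul _), integral_sub i1 (i2.const_mul _), integral_const_mul,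
    integral_const_mul, integral_corrPow h, integral_cpow_one_mul_corrPow h,
    integral_cpow_mul_corrPow h (by omega), thetaCoef, alphaCoef, sd_sq,
    show 2 * (m + 2) - 2 = m + 1 + (m + 1) by omega, show m + 2 - 1 = m + 1 by omega,
    Nat.add_sub_cancel]
  push_cast
  ring

end Coefficients

end SampleMoments

/-! ### The limit law. -/

theorem mainTheorem1 {Ω Ω' : Type*} [MeasurableSpace Ω] [MeasurableSpace Ω']
    (P : Measure Ω) [IsProbabilityMeasure P] (P' : Measure Ω') [IsProbabilityMeasure P']
    (k : ℕ) (hk : 2 ≤ k)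
    (F : Measure ℝ) [IsProbabilityMeasure F] (hF : SampleMoments.IsSingular F k)
    (X : ℕ → Ω → ℝ) (hXlaw : ∀ i, HasLaw (X i) F P) (hXindep : iIndepFun X P)
    (Z₁ Z₂ : Ω' → ℝ) (hZ₁ : HasLaw Z₁ (gaussianReal 0 1) P')
    (hZ₂ : HasLaw Z₂ (gaussianReal 0 1) P') (hZ : IndepFun Z₁ Z₂ P') :
    TendstoInDistribution
      (fun (n : ℕ) (ω : Ω) => (n : ℝ) *
        (SampleMoments.cm F k - SampleMoments.sampleCentralMoment k n (fun i => X i ω)))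
      atTop
      (fun ω' : Ω' =>
        (k : ℝ) / 2 *
            (SampleMoments.sd F * √(SampleMoments.thetaCoef F k) + SampleMoments.alphaCoef F k) *
            Z₁ ω' ^ 2 -
          (k : ℝ) / 2 *
            (SampleMoments.sd F * √(SampleMoments.thetaCoef F k) - SampleMoments.alphaCoef F k) *
            Z₂ ω' ^ 2)
      (fun _ => P) P' := by
  open SampleMoments in
  obtain ⟨m, rfl⟩ : ∃ m, k = m + 2 := ⟨k - 2, by omega⟩
  have hXm : ∀ i, AEMeasurable (X i) P := fun i => (hXlaw i).aemeasurable
  have h := hF.moment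
  obtain ⟨c, d, hcd, hα, hclt⟩ := exists_tendstoInDistribution_prodMk hXlaw hXindep hZ₁ hZ₂ hZ
    (measurable_cpow 1) measurable_corrPow (memLp_cpow h (by omega)) (memLp_corrPow h)
    (by rw [integral_cpow_eq_cm, cm_one]) (integral_corrPow h)
    (by simp_rw [cpow_mul_cpow]; exact integral_cpow_eq_cm 2) (integral_corrPow_mul_corrPow h)
    (integral_cpow_one_mul_corrPow h)
  set μ := ∫ y, y ∂F with hμ
  -- The limit of the quadratic coefficient is already absorbed by the correction in `corrPow`; only
  -- its error multiplies `U²`.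
  let G : ℕ → (ℕ → ℝ) → ℝ := fun n x =>
    ((m : ℝ) + 2) * (m + 1) / 2 * cm F m - quadTail μ m n x
  obtain ⟨hGm, hG⟩ := tendstoInMeasure_of_ae_tendsto_comp (P := P) (G := G) (a := 0)
    (fun n => by fun_prop) hXm (by
      filter_upwards [ae_tendsto_quadTail hXlaw hXindep h] with ω hω
      simpa using hω.const_sub (((m : ℝ) + 2) * (m + 1) / 2 * cm F m))
  have hlim := hclt.continuous_comp_prodMk_of_tendstoInMeasure_const
    (g := fun p : (ℝ × ℝ) × ℝ => (m + 2) * p.1.1 * p.1.2 + p.1.1 ^ 2 * p.2) (by fun_prop) hG hGm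
  have hae : ∀ᵐ ω ∂P, ∀ i, cpow F (m + 2) (X i ω) =
      cm F (m + 2) + (m + 2) * cm F (m + 1) * cpow F 1 (X i ω) :=
    ae_all_iff.2 fun i => ((hXlaw i).ae_iff (by
      refine measurableSet_setOfPred.1 (measurableSet_eq_fun ?_ ?_) <;> fun_prop)).2 hF.ae_cpow_eq
  refine hlim.congr (fun n => ?_) (ae_of_all _ fun ω => ?_)
  · filter_upwards [hae] with ω hω
    rcases eq_or_ne n 0 with rfl | hn
    · simp
    set x : ℕ → ℝ := fun i => X i ω with hx
    have e1 : (n : ℝ)⁻¹ * ∑ i ∈ Finset.range n, cpow F 1 (X i ω) = powAvg μ n x 1 := rfl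
    have e2 : (n : ℝ)⁻¹ * ∑ i ∈ Finset.range n, corrPow F m (X i ω) =
        powAvg μ n x (m + 1) - cm F (m + 1) - (m + 1) / 2 * cm F m * powAvg μ n x 1 := by
      simp only [corrPow, cpow, powAvg, Finset.sum_sub_distrib, ← Finset.mul_sum,
        Finset.sum_const, Finset.card_range, nsmul_eq_mul, hμ, hx]
      field_simp
    have e3 : powAvg μ n x (m + 2) =
        cm F (m + 2) + (m + 2) * cm F (m + 1) * powAvg μ n x 1 := by
      have : powAvg μ n x (m + 2) = (n : ℝ)⁻¹ * ∑ i ∈ Finset.range n, cpow F (m + 2) (X i ω) := rfl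
      rw [this, Finset.sum_congr rfl fun i _ => hω i, Finset.sum_add_distrib, ← Finset.mul_sum,
        ← e1, Finset.sum_const, Finset.card_range, nsmul_eq_mul]
      field_simp
    have e4 : √(n : ℝ) ^ 2 = n := Real.sq_sqrt (Nat.cast_nonneg n)
    simp only [G]
    rw [inv_sqrt_mul, inv_sqrt_mul, e1, e2, sampleCentralMoment_eq μ m hn, e3]
    linear_combination ((m + 2) * powAvg μ n x 1 * (powAvg μ n x (m + 1) - cm F (m + 1)) -
      powAvg μ n x 1 ^ 2 * quadTail μ m n x) * e4
  -- Substituting `α = σ√θ(c² - d²)` and `c² + d² = 1` turns the stated coefficients into those of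
  -- the product of the two limits.
  · have h1 : sd F * √(thetaCoef F (m + 2)) + alphaCoef F (m + 2) =
        2 * (sd F * √(thetaCoef F (m + 2))) * c ^ 2 := by
      rw [← hα, sd]
      linear_combination (-√(cm F 2) * √(thetaCoef F (m + 2))) * hcd
    have h2 : sd F * √(thetaCoef F (m + 2)) - alphaCoef F (m + 2) =
        2 * (sd F * √(thetaCoef F (m + 2))) * d ^ 2 := by
      rw [← hα, sd]
      linear_combination (-√(cm F 2) * √(thetaCoef F (m + 2))) * hcd
    rw [h1, h2, sd]
    push_cast
    ring
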